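/- First Blaschke–Petkantschin formula for pivoted spheres. Let $n \ge 1$, let $S^{n-1}$ be the unit sphere of $\mathbb{R}^n$ centered at the origin, equipped with its standard (unnormalized) surface measure (the counting measure on two points if $n = 1$), and let $f \colon (\mathbb{R}^n)^n \to [0,\infty]$ be a Lebesgue measurable function of $n$ points. Then $$\int_{x \in (\mathbb{R}^n)^n} f(x)\,dx = \int_{r \ge 0} \int_{z \in S^{n-1}} \int_{u \in (S^{n-1})^n} f(rz + ru)\, r^{n^2-1}\, n!\, \mathrm{Vol}_n(-z, u)\; du\, dz\, dr .$$ Here $dx$ is the $n$-fold product of the Lebesgue measure on $\mathbb{R}^n$, $dr$ is the Lebesgue measure on $[0,\infty)$, $dz$ is the surface measure on $S^{n-1}$, and $du$ is its $n$-fold product. For $u = (u_1, \dots, u_n)$, $rz + ru$ denotes the $n$-tuple $(rz + ru_1, \dots, rz + ru_n)$, all of whose points lie on the sphere of radius $r$ that is centered at $rz$ and passes through the origin, and $\mathrm{Vol}_n(-z, u)$ is the $n$-dimensional volume of the (possibly degenerate) simplex with vertices $-z, u_1, \dots, u_n$. -/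

import Mathlib

open MeasureTheory
open scoped ENNReal Nat

noncomputable section

/-- The unit sphere `S^(n-1)` of `ℝⁿ`, centered at the origin. -/
abbrev UnitSphere (n : ℕ) : Type :=
  Metric.sphere (0 : EuclideanSpace ℝ (Fin n)) 1

/-- The standard (surface) measure on `S^(n-1)`: the measure of `A` is `n` times the Lebesgue
measure of the cone `{t • a | 0 < t < 1, a ∈ A}`. For `n = 1` it is the counting measure
on two points. -/
def sphereMeasure (n : ℕ) : Measure (UnitSphere n) :=
  (volume : Measure (EuclideanSpace ℝ (Fin n))).toSphere

/-- The `n`-dimensional volume of the (possibly degenerate) simplex in `ℝⁿ` with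
vertices `p 0, …, p n`. -/
def simplexVolume {n : ℕ} (p : Fin (n + 1) → EuclideanSpace ℝ (Fin n)) : ℝ≥0∞ :=
  volume (convexHull ℝ (Set.range p))

end

/-!
The sphere of center `c` through the origin consists of the points `x` with `‖x‖² = 2⟪x, c⟫`. So if
each point is written as `x i = s i • v i` with a unit vector `v i` and `s i > 0`, then all `x i` are
on this sphere exactly if `s i = 2⟪v i, c⟫` for all `i`. For fixed linearly independent `v`, this is a
linear change of variables between `s` and `c`, with determinant `2 ^ n * |det v|`. Polar coordinates
in each point (`lintegral_pi_polar`), the independence of almost all `v` (`ae_absDet_ne_zero`) and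
this change of variables turn `∫ f` into an integral over the directions `v` and the center `c`
(`lintegral_eq_lintegral_directionCenter`), with density
`∏ i, (2⟪v i, c⟫) ^ (n - 1) * 2 ^ n * |det v|` on the set where all `⟪v i, c⟫` are positive.

Now let `c = r • z` with a unit vector `z`. Then `x i = r • z + r • u i`, where `u i` is the
reflection of `z` in the line of `v i`; equivalently, `u i + z = 2⟪v i, z⟫ • v i`. The map `v ↦ u`
doubles the angle to `z`; it takes the open hemisphere around `z` to the sphere without `-z`, with
`2 * (2⟪v, z⟫) ^ (n - 1) dv = ‖u + z‖ du` (`lintegral_sphere_doubling`). This comes from the Jacobian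
of a quadratic extension of the map to `ℝⁿ`. After the substitution in each direction, the powers of
`⟪v i, z⟫` are used up, and the factors `‖u i + z‖` combine with `|det v|` to `|det (u + z)|`, which
is `n!` times the volume of the simplex with vertices `-z, u 1, …, u n`
(`factorial_mul_simplexVolume`). The powers of `r`, namely `n` factors `r ^ (n - 1)` and one more from
polar coordinates for `c`, multiply to `r ^ (n² - 1)`.
-/

open scoped RealInnerProductSpace

noncomputable section

/-! ### Products of measures with densities -/

theorem lintegral_fin_prod_eq_prod {n : ℕ} {X : Fin n → Type*} [∀ i, MeasurableSpace (X i)]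
    (μ : ∀ i, Measure (X i)) [∀ i, SigmaFinite (μ i)] (g : ∀ i, X i → ℝ≥0∞)
    (hg : ∀ i, Measurable (g i)) :
    ∫⁻ x, ∏ i, g i (x i) ∂Measure.pi μ = ∏ i, ∫⁻ y, g i y ∂μ i := by
  induction n with
  | zero => simp
  | succ n ih =>
    rw [← (measurePreserving_piFinSuccAbove μ 0).symm.lintegral_comp_emb
      (MeasurableEquiv.measurableEmbedding _), Fin.prod_univ_succ]
    simp only [Fin.prod_univ_succ]
    have := ih (fun j => μ j.succ) (fun j => g j.succ) (fun j => hg _)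
    rw [← this, ← lintegral_prod_mul (hg 0).aemeasurable]
    · rfl
    · exact (Finset.measurable_prod _ fun i _ => (hg _).comp (measurable_pi_apply i)).aemeasurable

/-- A product of measures with densities has the product of the densities as its density. -/
theorem pi_withDensity {n : ℕ} {X : Fin n → Type*} [∀ i, MeasurableSpace (X i)]
    (μ : ∀ i, Measure (X i)) [∀ i, SigmaFinite (μ i)] (g : ∀ i, X i → ℝ≥0∞)
    (hg : ∀ i, Measurable (g i)) [∀ i, SigmaFinite ((μ i).withDensity (g i))] :
    Measure.pi (fun i => (μ i).withDensity (g i)) =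
      (Measure.pi μ).withDensity (fun x => ∏ i, g i (x i)) := by
  refine Measure.pi_eq fun s hs => ?_
  rw [withDensity_apply _ (MeasurableSet.univ_pi hs), ← lintegral_indicator (.univ_pi hs)]
  simp_rw [withDensity_apply _ (hs _), ← lintegral_indicator (hs _)]
  rw [← lintegral_fin_prod_eq_prod _ _ fun i => (hg i).indicator (hs i)]
  congr with x
  by_cases hx : x ∈ Set.univ.pi s
  · rw [Set.indicator_of_mem hx]
    exact Finset.prod_congr rfl fun i _ => by
      rw [Set.indicator_of_mem (hx i trivial)]
  · rw [Set.indicator_of_notMem hx]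
    simp only [Set.mem_pi, not_forall] at hx
    obtain ⟨i, _, hi⟩ := hx
    exact (Finset.prod_eq_zero (Finset.mem_univ i) (Set.indicator_of_notMem hi _)).symm


/-! ### Polar coordinates -/

/-- The density `s ^ (n - 1)` on `(0, ∞)`, extended by zero to `ℝ`: the radial part of Lebesgue
measure on `ℝⁿ` in polar coordinates. The case distinction is needed for odd `n`, where
the power alone is positive on `(-∞, 0)`. -/
def radialDensity (n : ℕ) (s : ℝ) : ℝ≥0∞ := if 0 < s then ENNReal.ofReal (s ^ (n - 1)) else 0

theorem measurable_radialDensity (n : ℕ) : Measurable (radialDensity n) :=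
  Measurable.ite measurableSet_Ioi (by fun_prop) measurable_const

theorem radialDensity_lt_top (n : ℕ) (s : ℝ) : radialDensity n s < ∞ := by
  unfold radialDensity; split_ifs <;> simp

theorem radialDensity_mul {n : ℕ} {r : ℝ} (hr : 0 < r) (s : ℝ) :
    radialDensity n (r * s) = ENNReal.ofReal (r ^ (n - 1)) * radialDensity n s := by
  unfold radialDensity
  simp only [mul_pos_iff_of_pos_left hr]
  split_ifs with h
  · rw [mul_pow, ENNReal.ofReal_mul (by positivity)]
  · simp

theorem lintegral_radialDensity_mul (n : ℕ) (g : ℝ → ℝ≥0∞) :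
    ∫⁻ s, radialDensity n s * g s = ∫⁻ s in Set.Ioi 0, ENNReal.ofReal (s ^ (n - 1)) * g s := by
  rw [← lintegral_indicator measurableSet_Ioi]
  congr with s
  simp [radialDensity, Set.indicator_apply]

/-- The measure on `ℝ` with density `radialDensity n`. Unlike `Measure.volumeIoiPow`, it lives on
the whole line, so that its powers are measures on a space of functions to `ℝ`. -/
def radialMeasure (n : ℕ) : Measure ℝ := volume.withDensity (radialDensity n)

instance (n : ℕ) : SigmaFinite (radialMeasure n) :=
  SigmaFinite.withDensity_of_ne_top
    (Filter.Eventually.of_forall fun s => (radialDensity_lt_top n s).ne)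

theorem map_volumeIoiPow (n : ℕ) :
    (Measure.volumeIoiPow (n - 1)).map Subtype.val = radialMeasure n := by
  ext s hs
  rw [Measure.map_apply measurable_subtype_coe hs, Measure.volumeIoiPow, radialMeasure,
    withDensity_apply _ hs, withDensity_apply _ (measurable_subtype_coe hs),
    setLIntegral_subtype measurableSet_Ioi _ fun a : ℝ ↦ .ofReal (a ^ (n - 1)),
    ← lintegral_indicator, ← lintegral_indicator hs]
  · congr with x
    by_cases h : 0 < x <;> by_cases h' : x ∈ s <;>
      simp [radialDensity, h, h']
  · exact (MeasurableEmbedding.subtype_coe measurableSet_Ioi).measurableSet_image.2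
      (measurable_subtype_coe hs)

instance (n : ℕ) : IsFiniteMeasure (sphereMeasure n) := by unfold sphereMeasure; infer_instance

theorem measurePreserving_polar {n : ℕ} (hn : 1 ≤ n) :
    MeasurePreserving (fun p : UnitSphere n × ℝ => p.2 • (p.1 : EuclideanSpace ℝ (Fin n)))
      ((sphereMeasure n).prod (radialMeasure n)) volume := by
  have : NeZero n := ⟨by omega⟩
  refine ⟨by fun_prop, ?_⟩
  have h1 := MeasurePreserving.symm
    (homeomorphUnitSphereProd (EuclideanSpace ℝ (Fin n))).toMeasurableEquiv
    (Measure.measurePreserving_homeomorphUnitSphereProd volume)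
  rw [finrank_euclideanSpace_fin] at h1
  have h2 : MeasurePreserving (Prod.map id Subtype.val)
      ((sphereMeasure n).prod (Measure.volumeIoiPow (n - 1)))
      ((sphereMeasure n).prod (radialMeasure n)) :=
    (MeasurePreserving.id _).prod ⟨measurable_subtype_coe, map_volumeIoiPow n⟩
  rw [← h2.map_eq, Measure.map_map (by fun_prop) h2.measurable]
  have h3 := congrArg (Measure.map Subtype.val) h1.map_eq
  rw [Measure.map_map measurable_subtype_coe h1.measurable,
    (MeasurableEmbedding.subtype_coe (measurableSet_singleton _).compl).map_comap,
    Subtype.range_coe, restrict_compl_singleton] at h3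
  exact h3

theorem lintegral_polar {n : ℕ} (hn : 1 ≤ n) {g : EuclideanSpace ℝ (Fin n) → ℝ≥0∞}
    (hg : Measurable g) :
    ∫⁻ x, g x = ∫⁻ v : UnitSphere n, ∫⁻ s in Set.Ioi (0 : ℝ),
      ENNReal.ofReal (s ^ (n - 1)) * g (s • (v : EuclideanSpace ℝ (Fin n)))
        ∂volume ∂sphereMeasure n := by
  rw [← (measurePreserving_polar hn).lintegral_comp hg, lintegral_prod _ (by fun_prop)]
  congr with v
  rw [radialMeasure, lintegral_withDensity_eq_lintegral_mul _ (measurable_radialDensity n)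
    (by fun_prop)]
  exact lintegral_radialDensity_mul n _

/-- Polar coordinates in each of `m` points of `ℝⁿ` separately. -/
theorem lintegral_pi_polar {n m : ℕ} (hn : 1 ≤ n)
    {g : (Fin m → EuclideanSpace ℝ (Fin n)) → ℝ≥0∞} (hg : Measurable g) :
    ∫⁻ x, g x = ∫⁻ v : Fin m → UnitSphere n, ∫⁻ s : Fin m → ℝ,
      (∏ i, radialDensity n (s i)) * g (fun i => s i • (v i : EuclideanSpace ℝ (Fin n)))
        ∂volume ∂Measure.pi fun _ => sphereMeasure n := by
  have h1 := measurePreserving_pi (ι := Fin m) _ _ fun _ => measurePreserving_polar hn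
  have h2 := h1.comp (measurePreserving_arrowProdEquivProdArrow (UnitSphere n) ℝ (Fin m)
    (fun _ => sphereMeasure n) (fun _ => radialMeasure n)).symm
  have h3 := h2.lintegral_comp hg
  rw [← volume_pi] at h3
  have hm : Measurable fun p : (Fin m → UnitSphere n) × (Fin m → ℝ) =>
      g (fun i => p.2 i • (p.1 i : EuclideanSpace ℝ (Fin n))) := by
    refine hg.comp (measurable_pi_lambda _ fun i => ?_)
    fun_prop
  rw [← h3, lintegral_prod]
  · congr with v
    have : SigmaFinite (volume.withDensity (radialDensity n)) :=
      inferInstanceAs (SigmaFinite (radialMeasure n))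
    unfold radialMeasure
    rw [pi_withDensity (fun _ : Fin m => (volume : Measure ℝ)) _
      (fun _ => measurable_radialDensity n), lintegral_withDensity_eq_lintegral_mul]
    · rfl
    · exact Finset.measurable_prod _ fun i _ =>
        (measurable_radialDensity n).comp (measurable_pi_apply i)
    · exact hm.comp measurable_prodMk_left
  · exact hm.aemeasurable

/-! ### Volume of a simplex -/

/-- The proof slices along the first coordinate. -/
theorem volume_cornerSimplex (n : ℕ) {t : ℝ} (ht : 0 ≤ t) :
    volume {x : Fin n → ℝ | (∀ i, 0 ≤ x i) ∧ ∑ i, x i ≤ t} = ENNReal.ofReal (t ^ n / n !) := by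
  induction n generalizing t with
  | zero => simp [ht, volume_pi]
  | succ n ih =>
    have hms : MeasurableSet {x : Fin (n + 1) → ℝ | (∀ i, 0 ≤ x i) ∧ ∑ i, x i ≤ t} := by
      measurability
    rw [← (volume_preserving_piFinSuccAbove (fun _ : Fin (n + 1) => ℝ) 0).symm.measure_preimage
      hms.nullMeasurableSet]
    rw [Measure.volume_eq_prod, Measure.prod_apply
      ((MeasurableEquiv.measurable _) hms)]
    have key : ∀ y : ℝ, volume (Prod.mk y ⁻¹'
        ((MeasurableEquiv.piFinSuccAbove (fun _ : Fin (n + 1) => ℝ) 0).symm ⁻¹'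
          {x : Fin (n + 1) → ℝ | (∀ i, 0 ≤ x i) ∧ ∑ i, x i ≤ t})) =
        (Set.Icc 0 t).indicator (fun y => ENNReal.ofReal ((t - y) ^ n / n !)) y := by
      intro y
      have hset : (Prod.mk y ⁻¹'
        ((MeasurableEquiv.piFinSuccAbove (fun _ : Fin (n + 1) => ℝ) 0).symm ⁻¹'
          {x : Fin (n + 1) → ℝ | (∀ i, 0 ≤ x i) ∧ ∑ i, x i ≤ t})) =
          {x : Fin n → ℝ | 0 ≤ y ∧ (∀ i, 0 ≤ x i) ∧ y + ∑ i, x i ≤ t} := by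
        ext x
        simp [MeasurableEquiv.piFinSuccAbove, Fin.forall_fin_succ, Fin.sum_univ_succ, and_assoc]
      rw [hset]
      by_cases hy : y ∈ Set.Icc 0 t
      · rw [Set.indicator_of_mem hy, ← ih (sub_nonneg.2 hy.2)]
        congr with x
        simp [hy.1, le_sub_iff_add_le']
      · rw [Set.indicator_of_notMem hy]
        refine (congrArg volume (Set.eq_empty_of_forall_notMem fun x => ?_)).trans measure_empty
        simp only [Set.mem_ofPred_eq]
        rintro ⟨h0, h1, h2⟩
        exact hy ⟨h0, by linarith [Finset.sum_nonneg fun i (_ : i ∈ Finset.univ) => h1 i]⟩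
    simp_rw [key]
    rw [lintegral_indicator measurableSet_Icc, ← ofReal_integral_eq_lintegral_ofReal]
    · congr 1
      rw [integral_Icc_eq_integral_Ioc, ← intervalIntegral.integral_of_le ht,
        intervalIntegral.integral_comp_sub_left (fun y => y ^ n / (n ! : ℝ))]
      simp [Nat.factorial_succ]
      field_simp
    · exact (Continuous.integrableOn_Icc (by fun_prop))
    · filter_upwards [ae_restrict_mem measurableSet_Icc] with y hy
      have := sub_nonneg.2 hy.2
      simp only [Pi.zero_apply]; positivity


/-- The absolute value of the determinant with rows `x 0, …, x (n - 1)`, that is, the volume of the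
parallelepiped they span. -/
def absDet {n : ℕ} (x : Fin n → EuclideanSpace ℝ (Fin n)) : ℝ≥0∞ :=
  ENNReal.ofReal |(Matrix.of fun i j => x i j).det|

theorem measurable_absDet {n : ℕ} :
    Measurable (absDet : (Fin n → EuclideanSpace ℝ (Fin n)) → ℝ≥0∞) := by
  unfold absDet
  refine ENNReal.measurable_ofReal.comp (Continuous.measurable ?_)
  refine continuous_abs.comp (Continuous.matrix_det ?_)
  refine continuous_matrix fun i j => ?_
  simp only [Matrix.of_apply]
  fun_prop

theorem absDet_smul {n : ℕ} (t : Fin n → ℝ) (x : Fin n → EuclideanSpace ℝ (Fin n)) :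
    absDet (fun i => t i • x i) = (∏ i, ENNReal.ofReal |t i|) * absDet x := by
  have := Matrix.det_mul_column t (Matrix.of fun i j => x i j)
  unfold absDet
  rw [← ENNReal.ofReal_prod_of_nonneg fun i _ => abs_nonneg _,
    ← ENNReal.ofReal_mul (by positivity), ← Finset.abs_prod, ← abs_mul, ← this]
  rfl

theorem convexHull_range_cons_zero_single (n : ℕ) :
    convexHull ℝ (Set.range (Fin.cons 0 (fun i => EuclideanSpace.single i (1 : ℝ)) :
        Fin (n + 1) → EuclideanSpace ℝ (Fin n))) =
      {x | (∀ i, 0 ≤ x i) ∧ ∑ i, x i ≤ 1} := by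
  refine Set.Subset.antisymm (convexHull_min ?_ ?_) ?_
  · rintro _ ⟨k, rfl⟩
    refine Fin.cases (by simp) (fun i => ?_) k
    refine ⟨fun j => ?_, by simp [PiLp.single_apply]⟩
    simp only [Fin.cons_succ, PiLp.single_apply]
    split_ifs <;> simp
  · rintro x ⟨hx, hx'⟩ y ⟨hy, hy'⟩ a b ha hb hab
    refine ⟨fun i => ?_, ?_⟩
    · have := hx i
      have := hy i
      simp only [PiLp.add_apply, PiLp.smul_apply, smul_eq_mul]
      positivity
    · simp only [PiLp.add_apply, PiLp.smul_apply, smul_eq_mul, Finset.sum_add_distrib,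
        ← Finset.mul_sum]
      nlinarith
  · rintro x ⟨hx, hx'⟩
    have hsum : x = ∑ k : Fin (n + 1), (Fin.cons (1 - ∑ i, x i) x : Fin (n + 1) → ℝ) k •
        (Fin.cons 0 (fun i => EuclideanSpace.single i (1 : ℝ)) :
          Fin (n + 1) → EuclideanSpace ℝ (Fin n)) k := by
      ext j
      simp [Fin.sum_univ_succ, Finset.sum_apply, Pi.single_apply]
    rw [hsum]
    refine (convex_convexHull ℝ _).sum_mem (fun k _ => ?_) (by simp [Fin.sum_univ_succ])
      fun k _ => subset_convexHull _ _ ⟨k, rfl⟩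
    exact Fin.cases (by simpa using hx') (fun i => by simpa using hx i) k

/-- The simplex is the image of the corner simplex under an affine map, and this holds for
degenerate simplices too: both sides are then zero. -/
theorem factorial_mul_simplexVolume {n : ℕ} (p : EuclideanSpace ℝ (Fin n))
    (x : Fin n → EuclideanSpace ℝ (Fin n)) :
    (n ! : ℝ≥0∞) * simplexVolume (Fin.cons p x : Fin (n + 1) → EuclideanSpace ℝ (Fin n)) =
      absDet (fun i => x i - p) := by
  set b := (EuclideanSpace.basisFun (Fin n) ℝ).toBasis with hb
  set M : Matrix (Fin n) (Fin n) ℝ := Matrix.of fun i j => (x i - p) j with hM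
  set L := Matrix.toLin b b M.transpose with hL
  have hLs : ∀ i, L (EuclideanSpace.single i 1) = x i - p := by
    intro i
    have : EuclideanSpace.single i (1 : ℝ) = b i := by simp [hb]
    rw [this, hL, Matrix.toLin_self]
    ext j
    simp [hb, hM, Pi.single_apply]
  have hrange : Set.range (Fin.cons p x : Fin (n + 1) → EuclideanSpace ℝ (Fin n)) =
      (fun y => p + y) '' (L '' Set.range (Fin.cons 0 (fun i => EuclideanSpace.single i (1 : ℝ)) :
        Fin (n + 1) → EuclideanSpace ℝ (Fin n))) := by
    rw [← Set.range_comp, ← Set.range_comp]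
    congr with k : 1
    refine Fin.cases (by simp) (fun i => by simp [hLs]) k
  have hhull : convexHull ℝ (Set.range (Fin.cons p x : Fin (n + 1) → EuclideanSpace ℝ (Fin n))) =
      (fun y => p + y) '' (L '' {x | (∀ i, 0 ≤ x i) ∧ ∑ i, x i ≤ 1}) := by
    rw [hrange, ← convexHull_range_cons_zero_single, LinearMap.image_convexHull]
    exact convexHull_vadd (𝕜 := ℝ) p _
  have hvol : volume {x : EuclideanSpace ℝ (Fin n) | (∀ i, 0 ≤ x i) ∧ ∑ i, x i ≤ 1} =
      ENNReal.ofReal (1 / n !) := by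
    have h := volume_cornerSimplex n zero_le_one
    rw [one_pow] at h
    rw [← h, ← (PiLp.volume_preserving_ofLp (Fin n)).measure_preimage]
    · rfl
    · refine MeasurableSet.nullMeasurableSet ?_
      measurability
  have hn : (n ! : ℝ) ≠ 0 := by positivity
  rw [simplexVolume, hhull, Set.image_add_left, measure_preimage_add, Measure.addHaar_image_linearMap,
    hvol, hL, LinearMap.det_toLin, Matrix.det_transpose, absDet, ← hM, mul_comm, mul_assoc,
    ← ENNReal.ofReal_natCast, ← ENNReal.ofReal_mul (by positivity), one_div, inv_mul_cancel₀ hn,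
    ENNReal.ofReal_one, mul_one]

/-! ### Linear coordinates dual to independent directions -/

/-- Change of variables `s i = ⟪v i, c⟫` for linearly independent `v`. -/
theorem lintegral_eq_absDet_mul {n : ℕ} {v : Fin n → EuclideanSpace ℝ (Fin n)}
    (hv : absDet v ≠ 0) {g : (Fin n → ℝ) → ℝ≥0∞} (hg : Measurable g) :
    ∫⁻ s, g s = absDet v * ∫⁻ c, g (fun i => inner ℝ (v i) c) := by
  set M : Matrix (Fin n) (Fin n) ℝ := Matrix.of fun i j => v i j with hM
  have hdet : M.det ≠ 0 := by
    contrapose! hv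
    simp [absDet, ← hM, hv]
  have h1 := Real.map_matrix_volume_pi_eq_smul_volume_pi hdet
  have h2 : absDet v • Measure.map (Matrix.toLin' M) volume = volume := by
    rw [h1, smul_smul, absDet, ← hM, ← ENNReal.ofReal_mul (abs_nonneg _), abs_inv,
      mul_inv_cancel₀ (abs_ne_zero.2 hdet)]
    simp
  have hmeas : Measurable (Matrix.toLin' M) :=
    (LinearMap.continuous_of_finiteDimensional _).measurable
  conv_lhs => rw [← h2]
  rw [lintegral_smul_measure, lintegral_map hg hmeas, smul_eq_mul,
    ← (PiLp.volume_preserving_ofLp (Fin n)).lintegral_comp (f := fun y => g (Matrix.toLin' M y))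
      (hg.comp hmeas)]
  congr! with c i
  simp [hM, PiLp.inner_apply, Matrix.mulVec, dotProduct, mul_comm]

/-- For a fixed matrix `X`, the determinant of `X + t • 1` vanishes for finitely many `t` only, so
by Fubini some translate of the set of singular matrices is null. -/
theorem ae_absDet_ne_zero_volume (n : ℕ) :
    ∀ᵐ x : Fin n → EuclideanSpace ℝ (Fin n), absDet x ≠ 0 := by
  set e : Fin n → EuclideanSpace ℝ (Fin n) := fun i => EuclideanSpace.single i 1 with he
  set S := {x : Fin n → EuclideanSpace ℝ (Fin n) | absDet x = 0}
  have hS : MeasurableSet S := measurable_absDet (measurableSet_singleton 0)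
  have hT : MeasurableSet {q : (Fin n → EuclideanSpace ℝ (Fin n)) × ℝ | q.1 + q.2 • e ∈ S} :=
    (show Measurable fun q : (Fin n → EuclideanSpace ℝ (Fin n)) × ℝ => q.1 + q.2 • e by
      fun_prop) hS
  have h1 : ((volume : Measure (Fin n → EuclideanSpace ℝ (Fin n))).prod (volume : Measure ℝ))
      {q | q.1 + q.2 • e ∈ S} = 0 := by
    refine (Measure.measure_prod_null hT).2 (Filter.Eventually.of_forall fun x => ?_)
    set M : Matrix (Fin n) (Fin n) ℝ := -Matrix.of fun i j => x i j with hM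
    -- The bad `t` are the eigenvalues of `-X`.
    refine (Set.Finite.subset (Polynomial.finite_setOfPred_isRoot (Matrix.charpoly_monic M).ne_zero)
      fun t ht => ?_).measure_zero _
    have ht : absDet (x + t • e) = 0 := ht
    rw [absDet, ENNReal.ofReal_eq_zero, abs_nonpos_iff] at ht
    rw [Set.mem_ofPred_eq, Polynomial.IsRoot, Matrix.eval_charpoly, ← ht]
    congr 1
    ext i j
    simp [hM, he, PiLp.single_apply, add_comm, eq_comm, Matrix.diagonal_apply]
  rw [← Measure.prod_swap, Measure.map_apply measurable_swap hT,
    Measure.measure_prod_null (measurable_swap hT)] at h1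
  obtain ⟨t, ht⟩ := h1.exists
  have h2 : volume ((fun x => x + t • e) ⁻¹' S) = 0 := ht
  rw [measure_preimage_add_right] at h2
  simpa [ae_iff] using h2

/-- Linear independence depends on the directions of the points only, so that the case of the sphere
follows from that of Lebesgue measure through polar coordinates. -/
theorem ae_absDet_ne_zero {n : ℕ} (hn : 1 ≤ n) :
    ∀ᵐ v : Fin n → UnitSphere n ∂Measure.pi fun _ => sphereMeasure n,
      absDet (fun i => (v i : EuclideanSpace ℝ (Fin n))) ≠ 0 := by
  set S := {x : Fin n → EuclideanSpace ℝ (Fin n) | absDet x = 0}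
  have hS : MeasurableSet S := measurable_absDet (measurableSet_singleton 0)
  have hg : Measurable (S.indicator (1 : (Fin n → EuclideanSpace ℝ (Fin n)) → ℝ≥0∞)) :=
    measurable_one.indicator hS
  have h0 : ∫⁻ x, S.indicator (1 : (Fin n → EuclideanSpace ℝ (Fin n)) → ℝ≥0∞) x = 0 := by
    rw [lintegral_indicator_one hS]
    simpa [ae_iff] using ae_absDet_ne_zero_volume n
  rw [lintegral_pi_polar hn hg, lintegral_eq_zero_iff] at h0
  · filter_upwards [h0] with v hv hdet
    have hmem : ∀ s : Fin n → ℝ, (fun i => s i • (v i : EuclideanSpace ℝ (Fin n))) ∈ S := by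
      intro s
      change absDet _ = 0
      rw [absDet_smul, hdet, mul_zero]
    simp only [Set.indicator_of_mem (hmem _), Pi.one_apply, mul_one, Pi.zero_apply] at hv
    rw [volume_pi, lintegral_fin_prod_eq_prod _ (fun _ => radialDensity n)
      fun _ => measurable_radialDensity n, Finset.prod_eq_zero_iff] at hv
    obtain ⟨i, -, hi⟩ := hv
    rw [lintegral_eq_zero_iff (measurable_radialDensity n)] at hi
    have h3 : volume (Set.Ioi (0 : ℝ)) = 0 := by
      refine measure_mono_null (fun s hs => ?_) (ae_iff.1 hi)
      have hs : 0 < s := hs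
      simp [radialDensity, hs]
    simp at h3
  · refine Measurable.lintegral_prod_right' (f := fun p : (Fin n → UnitSphere n) × (Fin n → ℝ) =>
      (∏ i, radialDensity n (p.2 i)) * S.indicator 1 (fun i => p.2 i •
        (p.1 i : EuclideanSpace ℝ (Fin n)))) ?_
    refine Measurable.mul (Finset.measurable_prod _ fun i _ =>
        (measurable_radialDensity n).comp (by fun_prop)) (hg.comp ?_)
    exact measurable_pi_lambda _ fun i => by fun_prop

/-! ### Doubling the angle to a pole -/

/-- The map that doubles the angle to the unit vector `z` and squares the norm. On the unit sphere
it is `w ↦ 2⟪w, z⟫w - z`, the reflection of `z` in the line of `w`. This extension to `ℝⁿ` is a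
quadratic polynomial. -/
def doubling {n : ℕ} (z w : EuclideanSpace ℝ (Fin n)) : EuclideanSpace ℝ (Fin n) :=
  (2 * ⟪w, z⟫) • w - ‖w‖ ^ 2 • z

/-- The derivative of `doubling z` at `w`. -/
def doublingDeriv {n : ℕ} (z w : EuclideanSpace ℝ (Fin n)) :
    EuclideanSpace ℝ (Fin n) →L[ℝ] EuclideanSpace ℝ (Fin n) :=
  (2 * ⟪w, z⟫) • ContinuousLinearMap.id ℝ _ + (2 • innerSL ℝ z).smulRight w
    - (2 • innerSL ℝ w).smulRight z

theorem hasFDerivAt_doubling {n : ℕ} (z w : EuclideanSpace ℝ (Fin n)) :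
    HasFDerivAt (doubling z) (doublingDeriv z w) w := by
  have h1 : HasFDerivAt (fun w => 2 * ⟪w, z⟫) (2 • innerSL ℝ z) w := by
    have := ((innerSL ℝ z).hasFDerivAt (x := w)).const_smul (2 : ℝ)
    refine (this.congr_of_eventuallyEq (Filter.Eventually.of_forall fun y => ?_)).congr_fderiv ?_
    · simp [real_inner_comm]
    · ext; simp
  have h2 : HasFDerivAt (fun w : EuclideanSpace ℝ (Fin n) => ‖w‖ ^ 2) (2 • innerSL ℝ w) w :=
    (hasStrictFDerivAt_norm_sq w).hasFDerivAt
  exact (h1.smul (hasFDerivAt_id w)).sub (h2.smul_const z)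

/-- Stated without division, as `2 ^ n * ⟪w, z⟫ ^ (n - 2) * ‖w‖ ^ 2` is the wrong expression in `ℕ`
for `n = 1`. The derivative is a multiple of the identity plus an operator of rank at most two, so
that the determinant reduces to one of size two. -/
theorem det_doublingDeriv {n : ℕ} {z w : EuclideanSpace ℝ (Fin n)} (hz : ‖z‖ = 1)
    (hw : ⟪w, z⟫ ≠ 0) :
    ⟪w, z⟫ ^ 2 * (doublingDeriv z w).det = 2 ^ n * ⟪w, z⟫ ^ n * ‖w‖ ^ 2 := by
  set a := ⟪w, z⟫ with ha
  set b := (EuclideanSpace.basisFun (Fin n) ℝ).toBasis with hb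
  set U : Matrix (Fin n) (Fin 2) ℝ := Matrix.of fun i => ![w i, - z i] with hU
  set V : Matrix (Fin 2) (Fin n) ℝ := Matrix.of ![fun j => a⁻¹ * z j, fun j => a⁻¹ * w j] with hV
  have hmat : LinearMap.toMatrix b b (doublingDeriv z w) = (2 * a) • (1 + U * V) := by
    ext i j
    simp [LinearMap.toMatrix_apply, hb, doublingDeriv, hU, hV, Matrix.mul_apply, Fin.sum_univ_two,
      ← ha, Matrix.one_apply, PiLp.single_apply, PiLp.inner_apply]
    field_simp
    split_ifs <;> ring
  have hzz : ∑ i, z i * z i = 1 := by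
    rw [← one_pow 2, ← hz, EuclideanSpace.real_norm_sq_eq]
    exact Finset.sum_congr rfl fun i _ => (sq _).symm
  have hww : ∑ i, w i * w i = ‖w‖ ^ 2 := by
    rw [EuclideanSpace.real_norm_sq_eq]
    exact Finset.sum_congr rfl fun i _ => (sq _).symm
  have hzw : ∑ i, z i * w i = a := by
    simp [ha, PiLp.inner_apply]
  have hwz : ∑ i, w i * z i = a := by simpa only [mul_comm] using hzw
  have hdet : (1 + V * U).det = a⁻¹ ^ 2 * ‖w‖ ^ 2 := by
    rw [Matrix.det_fin_two]
    simp only [Matrix.add_apply, Matrix.mul_apply, hU, hV, Matrix.of_apply, Matrix.one_apply,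
      Matrix.cons_val_zero, Matrix.cons_val_one, mul_assoc, ← Finset.mul_sum, mul_neg,
      Finset.sum_neg_distrib, hzz, hww, hzw, hwz]
    simp
    field_simp
    ring
  rw [ContinuousLinearMap.det, ← LinearMap.det_toMatrix b, hmat, Matrix.det_smul,
    Matrix.det_one_add_mul_comm, hdet]
  simp [mul_pow]
  field_simp

variable {n : ℕ} {z : EuclideanSpace ℝ (Fin n)}

theorem norm_doubling (hz : ‖z‖ = 1) (w : EuclideanSpace ℝ (Fin n)) :
    ‖doubling z w‖ = ‖w‖ ^ 2 := by
  rw [← sq_eq_sq₀ (norm_nonneg _) (by positivity), doubling, norm_sub_sq_real, norm_smul,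
    norm_smul, real_inner_smul_left, real_inner_smul_right, hz]
  simp only [Real.norm_eq_abs, mul_pow, sq_abs]
  ring

theorem doubling_add_norm_smul (hz : ‖z‖ = 1) (w : EuclideanSpace ℝ (Fin n)) :
    doubling z w + ‖doubling z w‖ • z = (2 * ⟪w, z⟫) • w := by
  rw [norm_doubling hz, doubling, sub_add_cancel]

theorem doubling_smul (r : ℝ) (w : EuclideanSpace ℝ (Fin n)) :
    doubling z (r • w) = r ^ 2 • doubling z w := by
  simp only [doubling, real_inner_smul_left, norm_smul, mul_pow, Real.norm_eq_abs, sq_abs]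
  module

theorem ne_zero_of_inner_pos {w : EuclideanSpace ℝ (Fin n)} (hw : 0 < ⟪w, z⟫) : w ≠ 0 := by
  rintro rfl
  simp at hw

theorem injOn_doubling (hz : ‖z‖ = 1) : Set.InjOn (doubling z) {w | 0 < ⟪w, z⟫} := by
  intro w hw w' hw' h
  have hw : 0 < ⟪w, z⟫ := hw
  have hw' : 0 < ⟪w', z⟫ := hw'
  have hnorm : ‖w‖ = ‖w'‖ := by
    have := congrArg norm h
    rwa [norm_doubling hz, norm_doubling hz, sq_eq_sq₀ (norm_nonneg _) (norm_nonneg _)] at this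
  have hsmul : (2 * ⟪w, z⟫) • w = (2 * ⟪w', z⟫) • w' := by
    rw [← doubling_add_norm_smul hz, ← doubling_add_norm_smul hz, h]
  have hinner : ⟪w, z⟫ = ⟪w', z⟫ := by
    have := congrArg norm hsmul
    rw [norm_smul, norm_smul, hnorm, Real.norm_of_nonneg (by positivity),
      Real.norm_of_nonneg (by positivity)] at this
    have h0 := norm_ne_zero_iff.2 (ne_zero_of_inner_pos hw')
    linarith [mul_right_cancel₀ h0 this]
  rw [hinner] at hsmul
  exact smul_right_injective _ (by positivity : 2 * ⟪w', z⟫ ≠ 0) hsmul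

/-- On the open half-space around `z` the map misses only the ray opposite to `z` and the origin. -/
theorem image_doubling (hz : ‖z‖ = 1) :
    doubling z '' {w | 0 < ⟪w, z⟫} = {y | y + ‖y‖ • z ≠ 0} := by
  ext y
  constructor
  · rintro ⟨w, hw, rfl⟩
    have hw : 0 < ⟪w, z⟫ := hw
    change _ ≠ _
    rw [doubling_add_norm_smul hz]
    exact smul_ne_zero (by positivity) (ne_zero_of_inner_pos hw)
  · intro hy
    have hy : y + ‖y‖ • z ≠ 0 := hy
    have hy0 : 0 < ‖y‖ := by
      rw [norm_pos_iff]
      rintro rfl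
      simp at hy
    set p := y + ‖y‖ • z with hp
    have hp0 : 0 < ‖p‖ := norm_pos_iff.2 hy
    have hpz : ‖p‖ ^ 2 = 2 * ‖y‖ * ⟪p, z⟫ := by
      rw [hp, norm_add_sq_real, inner_add_left, norm_smul, real_inner_smul_left,
        real_inner_smul_right, real_inner_self_eq_norm_sq, hz, norm_norm]
      ring
    set t := √‖y‖ / ‖p‖ with ht
    have ht0 : 0 < t := by positivity
    have ht2 : t ^ 2 * ‖p‖ ^ 2 = ‖y‖ := by
      rw [ht, div_pow, Real.sq_sqrt hy0.le]
      field_simp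
    have hpz0 : 0 < ⟪p, z⟫ := by
      by_contra! h
      nlinarith [pow_pos hp0 2]
    refine ⟨t • p, ?_, ?_⟩
    · change 0 < ⟪t • p, z⟫
      rw [real_inner_smul_left]
      positivity
    · have h1 : t ^ 2 * (2 * ⟪p, z⟫) = 1 := by
        rw [hpz] at ht2
        have : ‖y‖ * (t ^ 2 * (2 * ⟪p, z⟫)) = ‖y‖ * 1 := by linarith
        exact mul_left_cancel₀ hy0.ne' this
      rw [doubling_smul, doubling, smul_sub, smul_smul, smul_smul, h1, ht2, one_smul, hp,
        add_sub_cancel_right]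

theorem lintegral_Ioi_pow_of_lt_one (k : ℕ) :
    ∫⁻ r in Set.Ioi (0 : ℝ), (if r < 1 then ENNReal.ofReal (r ^ k) else 0) =
      ENNReal.ofReal (1 / (k + 1)) := by
  have : (fun r : ℝ => if r < 1 then ENNReal.ofReal (r ^ k) else 0) =
      (Set.Iio 1).indicator fun r => ENNReal.ofReal (r ^ k) := by
    ext r
    simp [Set.indicator_apply]
  rw [this, setLIntegral_indicator measurableSet_Iio, Set.inter_comm, Set.Ioi_inter_Iio,
    ← ofReal_integral_eq_lintegral_ofReal, ← integral_Ioc_eq_integral_Ioo,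
    ← intervalIntegral.integral_of_le zero_le_one]
  · simp
  · exact (Continuous.integrableOn_Icc (by fun_prop)).mono_set Set.Ioo_subset_Icc_self
  · filter_upwards [ae_restrict_mem measurableSet_Ioo] with r hr
    exact pow_nonneg hr.1.le _

theorem continuous_doubling : Continuous (doubling z) := by
  unfold doubling
  fun_prop

theorem abs_det_doublingDeriv_smul (hn : 1 ≤ n) (hz : ‖z‖ = 1) {v : EuclideanSpace ℝ (Fin n)}
    (hv : ‖v‖ = 1) (hvz : 0 < ⟪v, z⟫) {r : ℝ} (hr : 0 < r) :
    |(doublingDeriv z (r • v)).det| * ⟪v, z⟫ = 2 * r ^ n * (2 * ⟪v, z⟫) ^ (n - 1) := by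
  obtain ⟨m, rfl⟩ : ∃ m, n = m + 1 := ⟨n - 1, by omega⟩
  have hne : ⟪r • v, z⟫ ≠ 0 := by
    rw [real_inner_smul_left]
    positivity
  have h := det_doublingDeriv hz hne
  rw [real_inner_smul_left, norm_smul, hv, Real.norm_of_nonneg hr.le] at h
  have h' : (doublingDeriv z (r • v)).det * ⟪v, z⟫ = 2 * r ^ (m + 1) * (2 * ⟪v, z⟫) ^ m := by
    have hc : r ^ 2 * ⟪v, z⟫ ≠ 0 := by positivity
    refine mul_left_cancel₀ hc ?_
    rw [mul_pow 2]
    linear_combination h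
  rw [← abs_of_pos hvz, ← abs_mul, h', abs_of_pos hvz, abs_of_pos (by positivity)]
  simp

theorem measurable_det_doublingDeriv : Measurable fun w => (doublingDeriv z w).det := by
  have : doublingDeriv z = fderiv ℝ (doubling z) :=
    funext fun w => (hasFDerivAt_doubling z w).fderiv.symm
  rw [this]
  exact ContinuousLinearMap.continuous_det.measurable.comp (measurable_fderiv ℝ _)

/-- The change of variables `u = doubling z v` from the open hemisphere around `z` to the sphere, in
the form `2 * (2 * ⟪v, z⟫) ^ (n - 1) dv = ‖u + z‖ du`. The weight `‖u + z‖ = 2 * ⟪v, z⟫` kills the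
point `-z`, which is not in the image; this point is not null if `n = 1`. The proof integrates a
homogeneous extension over the unit ball of `ℝⁿ`, once directly and once through `doubling z`. -/
theorem lintegral_sphere_doubling (hn : 1 ≤ n) (hz : ‖z‖ = 1)
    {G : EuclideanSpace ℝ (Fin n) → ℝ≥0∞} (hG : Measurable G) :
    ∫⁻ v : UnitSphere n, 2 * radialDensity n (2 * ⟪(v : EuclideanSpace ℝ (Fin n)), z⟫) *
        G (doubling z v) ∂sphereMeasure n =
      ∫⁻ u : UnitSphere n, ENNReal.ofReal ‖(u : EuclideanSpace ℝ (Fin n)) + z‖ * G u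
        ∂sphereMeasure n := by
  set H := {w : EuclideanSpace ℝ (Fin n) | 0 < ⟪w, z⟫} with hH
  have hHm : MeasurableSet H := measurableSet_lt measurable_const (by fun_prop)
  set F : EuclideanSpace ℝ (Fin n) → ℝ≥0∞ := fun y =>
    if ‖y‖ < 1 then ENNReal.ofReal ‖y + ‖y‖ • z‖ * G (‖y‖⁻¹ • y) else 0 with hF
  have hFm : Measurable F :=
    Measurable.ite (measurableSet_lt measurable_norm measurable_const) (by fun_prop)
      measurable_const
  have hchange : ∫⁻ w in H, ENNReal.ofReal |(doublingDeriv z w).det| * F (doubling z w) =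
      ∫⁻ y, F y := by
    rw [← lintegral_image_eq_lintegral_abs_det_fderiv_mul volume hHm
      (fun w _ => (hasFDerivAt_doubling z w).hasFDerivWithinAt) (injOn_doubling hz),
      image_doubling hz]
    refine setLIntegral_eq_of_support_subset fun y hy => ?_
    contrapose! hy
    have hy : y + ‖y‖ • z = 0 := by simpa using hy
    simp [hF, hy]
  have hFpolar : ∫⁻ y, F y = ENNReal.ofReal (1 / (n + 1)) *
      ∫⁻ u : UnitSphere n, ENNReal.ofReal ‖(u : EuclideanSpace ℝ (Fin n)) + z‖ * G u
        ∂sphereMeasure n := by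
    rw [lintegral_polar hn hFm, ← lintegral_const_mul _ (by fun_prop)]
    congr with u
    have hu : ‖(u : EuclideanSpace ℝ (Fin n))‖ = 1 := by simp
    rw [← lintegral_Ioi_pow_of_lt_one, ← lintegral_mul_const _ (Measurable.ite measurableSet_Iio
      (by fun_prop) measurable_const)]
    refine setLIntegral_congr_fun measurableSet_Ioi fun r hr => ?_
    have hr : 0 < r := hr
    simp only [hF, norm_smul, Real.norm_of_nonneg hr.le, hu, mul_one]
    split_ifs
    · rw [← smul_add, norm_smul, Real.norm_of_nonneg hr.le, smul_smul, inv_mul_cancel₀ hr.ne',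
        one_smul, ENNReal.ofReal_mul hr.le, ← mul_assoc, ← mul_assoc,
        ← ENNReal.ofReal_mul (by positivity), ← pow_succ, Nat.sub_add_cancel hn,
        mul_assoc]
    · simp
  have hHpolar : ∫⁻ w in H, ENNReal.ofReal |(doublingDeriv z w).det| * F (doubling z w) =
      ENNReal.ofReal (1 / (n + 1)) *
        ∫⁻ v : UnitSphere n, 2 * radialDensity n (2 * ⟪(v : EuclideanSpace ℝ (Fin n)), z⟫) *
          G (doubling z v) ∂sphereMeasure n := by
    have hdm := measurable_det_doublingDeriv (z := z)
    have hdc := (continuous_doubling (z := z)).measurable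
    have hrm := measurable_radialDensity n
    have hsm : Measurable fun v : UnitSphere n => (v : EuclideanSpace ℝ (Fin n)) :=
      measurable_subtype_coe
    -- The integrals of `r ^ n` and of `2 * r ^ (2 * n + 1)` over `(0, 1)` agree.
    have hc : ENNReal.ofReal (1 / (n + 1)) = ENNReal.ofReal (1 / ((2 * n + 1 : ℕ) + 1)) * 2 := by
      rw [← ENNReal.ofReal_ofNat 2, ← ENNReal.ofReal_mul (by positivity)]
      congr 1
      push_cast
      field_simp
      ring
    rw [← lintegral_indicator hHm, lintegral_polar hn, hc, mul_assoc,
      ← lintegral_const_mul _ (by fun_prop), ← lintegral_const_mul _ (by fun_prop)]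
    · congr with v
      have hv : ‖(v : EuclideanSpace ℝ (Fin n))‖ = 1 := by simp
      rw [← lintegral_Ioi_pow_of_lt_one, ← lintegral_mul_const _ (Measurable.ite measurableSet_Iio
        (by fun_prop) measurable_const)]
      refine setLIntegral_congr_fun measurableSet_Ioi fun r hr => ?_
      have hr : 0 < r := hr
      by_cases ha : 0 < ⟪(v : EuclideanSpace ℝ (Fin n)), z⟫
      · have hmem : r • (v : EuclideanSpace ℝ (Fin n)) ∈ H := by
          change 0 < ⟪_, _⟫
          rw [real_inner_smul_left]
          positivity
        have hra : 0 < 2 * ⟪(v : EuclideanSpace ℝ (Fin n)), z⟫ := by positivity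
        have hadd : doubling z (v : EuclideanSpace ℝ (Fin n)) + z =
            (2 * ⟪(v : EuclideanSpace ℝ (Fin n)), z⟫) • (v : EuclideanSpace ℝ (Fin n)) := by
          rw [← doubling_add_norm_smul hz, norm_doubling hz, hv, one_pow, one_smul]
        have hlt : r ^ 2 < 1 ↔ r < 1 := by
          rw [sq_lt_one_iff₀ hr.le]
        rw [Set.indicator_of_mem hmem]
        simp only [hF, doubling_smul, norm_smul, norm_doubling hz, hv, one_pow, mul_one, norm_pow,
          Real.norm_of_nonneg hr.le, hlt, radialDensity, if_pos hra]
        split_ifs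
        · rw [← smul_add, hadd, norm_smul, norm_smul, hv, smul_smul,
            inv_mul_cancel₀ (by positivity), one_smul, norm_pow, Real.norm_of_nonneg hr.le,
            Real.norm_of_nonneg hra.le]
          simp only [← mul_assoc]
          congr 1
          have hdet := abs_det_doublingDeriv_smul hn hz hv ha hr
          generalize (doublingDeriv z (r • (v : EuclideanSpace ℝ (Fin n)))).det = D at hdet ⊢
          generalize ⟪(v : EuclideanSpace ℝ (Fin n)), z⟫ = a at ha hra hdet ⊢
          have h2 : (2 : ℝ≥0∞) = ENNReal.ofReal 2 := by simp
          rw [h2, ← ENNReal.ofReal_mul (by positivity),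
            ← ENNReal.ofReal_mul (by positivity), ← ENNReal.ofReal_mul (by positivity),
            ← ENNReal.ofReal_mul (by positivity), ← ENNReal.ofReal_mul (by positivity)]
          congr 1
          obtain ⟨m, rfl⟩ : ∃ m, n = m + 1 := ⟨n - 1, by omega⟩
          simp only [Nat.add_sub_cancel] at hdet ⊢
          linear_combination (2 * r ^ m * r ^ 2) * hdet
        · simp
      · have hmem : r • (v : EuclideanSpace ℝ (Fin n)) ∉ H := by
          change ¬ 0 < ⟪_, _⟫
          rw [real_inner_smul_left, mul_pos_iff_of_pos_left hr]
          exact ha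
        rw [Set.indicator_of_notMem hmem]
        simp [radialDensity, ha]
    · exact Measurable.indicator (by fun_prop) hHm
  have hc : ENNReal.ofReal (1 / (n + 1)) ≠ 0 := by
    simp only [ne_eq, ENNReal.ofReal_eq_zero, not_le]
    positivity
  rw [hHpolar, hFpolar] at hchange
  exact (ENNReal.mul_right_inj hc ENNReal.ofReal_ne_top).1 hchange

/-- `doubling z` as a map of the unit sphere to itself. -/
def sphereDoubling (z v : UnitSphere n) : UnitSphere n :=
  ⟨doubling (z : EuclideanSpace ℝ (Fin n)) v, by
    rw [mem_sphere_zero_iff_norm, norm_doubling (by simp)]; simp⟩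

theorem measurable_sphereDoubling (z : UnitSphere n) : Measurable (sphereDoubling z) :=
  (continuous_doubling.measurable.comp measurable_subtype_coe).subtype_mk

theorem coe_sphereDoubling_add (z v : UnitSphere n) :
    (sphereDoubling z v + z : EuclideanSpace ℝ (Fin n)) =
      (2 * ⟪(v : EuclideanSpace ℝ (Fin n)), z⟫) • (v : EuclideanSpace ℝ (Fin n)) := by
  rw [← doubling_add_norm_smul (by simp), norm_doubling (by simp)]
  simp [sphereDoubling]

theorem measurable_sphere_radialDensity (z : UnitSphere n) : Measurable fun v : UnitSphere n =>
    2 * radialDensity n (2 * ⟪(v : EuclideanSpace ℝ (Fin n)), z⟫) := by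
  have hrm := measurable_radialDensity n
  fun_prop

theorem map_sphereDoubling (hn : 1 ≤ n) (z : UnitSphere n) :
    ((sphereMeasure n).withDensity fun v =>
      2 * radialDensity n (2 * ⟪(v : EuclideanSpace ℝ (Fin n)), z⟫)).map (sphereDoubling z) =
    (sphereMeasure n).withDensity fun u =>
      ENNReal.ofReal ‖(u + z : EuclideanSpace ℝ (Fin n))‖ := by
  ext s hs
  obtain ⟨B, hB, rfl⟩ := hs
  have hs : MeasurableSet (Subtype.val ⁻¹' B : Set (UnitSphere n)) := measurable_subtype_coe hB
  have hs' := measurable_sphereDoubling z hs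
  rw [Measure.map_apply (measurable_sphereDoubling z) hs, withDensity_apply _ hs',
    withDensity_apply _ hs, ← lintegral_indicator hs', ← lintegral_indicator hs]
  have h := lintegral_sphere_doubling hn (z := z) (by simp)
    (measurable_one.indicator hB :
      Measurable (B.indicator (1 : EuclideanSpace ℝ (Fin n) → ℝ≥0∞)))
  convert h using 3 with v u
  · by_cases hv : doubling (z : EuclideanSpace ℝ (Fin n)) v ∈ B <;>
      simp [hv, sphereDoubling]
  · by_cases hu : (u : EuclideanSpace ℝ (Fin n)) ∈ B <;> simp [hu]

theorem lintegral_pi_sphereDoubling {m : ℕ} (hn : 1 ≤ n) (z : UnitSphere n)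
    {G : (Fin m → UnitSphere n) → ℝ≥0∞} (hG : Measurable G) :
    ∫⁻ v : Fin m → UnitSphere n,
        (∏ i, 2 * radialDensity n (2 * ⟪(v i : EuclideanSpace ℝ (Fin n)), z⟫)) *
          G (fun i => sphereDoubling z (v i)) ∂Measure.pi (fun _ => sphereMeasure n) =
      ∫⁻ u : Fin m → UnitSphere n,
        (∏ i, ENNReal.ofReal ‖(u i + z : EuclideanSpace ℝ (Fin n))‖) * G u
          ∂Measure.pi (fun _ => sphereMeasure n) := by
  have hrm := measurable_radialDensity n
  have hd := measurable_sphere_radialDensity z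
  have he : Measurable fun u : UnitSphere n =>
    ENNReal.ofReal ‖(u + z : EuclideanSpace ℝ (Fin n))‖ := by fun_prop
  have : SigmaFinite ((sphereMeasure n).withDensity fun v =>
      2 * radialDensity n (2 * ⟪(v : EuclideanSpace ℝ (Fin n)), z⟫)) :=
    SigmaFinite.withDensity_of_ne_top (Filter.Eventually.of_forall fun v =>
      ENNReal.mul_ne_top (by simp) (radialDensity_lt_top _ _).ne)
  have : SigmaFinite ((sphereMeasure n).withDensity fun u =>
      ENNReal.ofReal ‖(u + z : EuclideanSpace ℝ (Fin n))‖) :=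
    SigmaFinite.withDensity_of_ne_top (Filter.Eventually.of_forall fun v => ENNReal.ofReal_ne_top)
  have h1 : MeasurePreserving (fun (v : Fin m → UnitSphere n) i => sphereDoubling z (v i)) _ _ :=
    measurePreserving_pi _ _ fun _ : Fin m =>
      ⟨measurable_sphereDoubling z, map_sphereDoubling hn z⟩
  have h2 := h1.lintegral_comp hG
  rw [pi_withDensity _ _ fun _ => hd, pi_withDensity _ _ fun _ => he,
    lintegral_withDensity_eq_lintegral_mul _ (by fun_prop) hG,
    lintegral_withDensity_eq_lintegral_mul _ (by fun_prop)
      (show Measurable fun v : Fin m → UnitSphere n => G fun i => sphereDoubling z (v i) from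
        hG.comp h1.measurable)] at h2
  exact h2

/-! ### Points as intersections of rays with a sphere -/

/-- The density, in terms of directions `v i` and a center `c`, of the integral of `f` over points
`x i = (2 * ⟪v i, c⟫) • v i`: the second intersections of the rays spanned by the `v i` with the
sphere of center `c` through the origin. It vanishes unless all `⟪v i, c⟫` are positive. -/
def directionCenterIntegrand (f : (Fin n → EuclideanSpace ℝ (Fin n)) → ℝ≥0∞)
    (v : Fin n → UnitSphere n) (c : EuclideanSpace ℝ (Fin n)) : ℝ≥0∞ :=
  (∏ i, radialDensity n (2 * ⟪(v i : EuclideanSpace ℝ (Fin n)), c⟫)) *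
    f (fun i => (2 * ⟪(v i : EuclideanSpace ℝ (Fin n)), c⟫) • (v i : EuclideanSpace ℝ (Fin n))) *
      (2 ^ n * absDet fun i => (v i : EuclideanSpace ℝ (Fin n)))

theorem measurable_directionCenterIntegrand {f : (Fin n → EuclideanSpace ℝ (Fin n)) → ℝ≥0∞}
    (hf : Measurable f) :
    Measurable fun p : (Fin n → UnitSphere n) × EuclideanSpace ℝ (Fin n) =>
      directionCenterIntegrand f p.1 p.2 := by
  have hrm := measurable_radialDensity n
  have hdm := measurable_absDet (n := n)
  unfold directionCenterIntegrand
  fun_prop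

/-- For fixed independent directions `v i`, the distances of the points to the origin are the linear
coordinates `2 * ⟪v i, c⟫` of the center. -/
theorem lintegral_eq_lintegral_directionCenter (hn : 1 ≤ n)
    {f : (Fin n → EuclideanSpace ℝ (Fin n)) → ℝ≥0∞} (hf : Measurable f) :
    ∫⁻ x, f x = ∫⁻ v : Fin n → UnitSphere n, ∫⁻ c, directionCenterIntegrand f v c
      ∂volume ∂Measure.pi fun _ => sphereMeasure n := by
  rw [lintegral_pi_polar hn hf]
  refine lintegral_congr_ae ?_
  filter_upwards [ae_absDet_ne_zero hn] with v hv
  have hrm := measurable_radialDensity n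
  have h2 : absDet (fun i => (2 : ℝ) • (v i : EuclideanSpace ℝ (Fin n))) =
      2 ^ n * absDet fun i => (v i : EuclideanSpace ℝ (Fin n)) := by
    rw [absDet_smul]
    simp
  have hv' : absDet (fun i => (2 : ℝ) • (v i : EuclideanSpace ℝ (Fin n))) ≠ 0 := by
    rw [h2]
    exact mul_ne_zero (by simp) hv
  rw [lintegral_eq_absDet_mul hv' (by fun_prop), ← lintegral_const_mul _ (by fun_prop)]
  simp only [directionCenterIntegrand, real_inner_smul_left, h2]
  congr with c
  ring

/-! ### From directions to points of the pivoted sphere -/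

/-- The integrand over `u` divided by `∏ i, ‖u i + z‖`, the factor that the change of variables by
`sphereDoubling z` provides. If some `u i = -z`, then the normalized vector is `0` by the convention
`0⁻¹ = 0`, and the value is `0`. -/
def pivotIntegrand (f : (Fin n → EuclideanSpace ℝ (Fin n)) → ℝ≥0∞) (z : UnitSphere n) (r : ℝ)
    (u : Fin n → UnitSphere n) : ℝ≥0∞ :=
  f (fun i => r • (z : EuclideanSpace ℝ (Fin n)) + r • (u i : EuclideanSpace ℝ (Fin n))) *
    ENNReal.ofReal (r ^ (n ^ 2 - 1)) *
      absDet (fun i => ‖(u i + z : EuclideanSpace ℝ (Fin n))‖⁻¹ •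
        (u i + z : EuclideanSpace ℝ (Fin n)))

theorem measurable_pivotIntegrand {f : (Fin n → EuclideanSpace ℝ (Fin n)) → ℝ≥0∞}
    (hf : Measurable f) (z : UnitSphere n) (r : ℝ) : Measurable (pivotIntegrand f z r) := by
  have hdm := measurable_absDet (n := n)
  unfold pivotIntegrand
  fun_prop

theorem prod_norm_mul_pivotIntegrand (f : (Fin n → EuclideanSpace ℝ (Fin n)) → ℝ≥0∞)
    (z : UnitSphere n) (r : ℝ) (u : Fin n → UnitSphere n) :
    (∏ i, ENNReal.ofReal ‖(u i + z : EuclideanSpace ℝ (Fin n))‖) * pivotIntegrand f z r u =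
      f (fun i => r • (z : EuclideanSpace ℝ (Fin n)) + r • (u i : EuclideanSpace ℝ (Fin n))) *
        ENNReal.ofReal (r ^ (n ^ 2 - 1)) *
        ((n ! : ℝ≥0∞) * simplexVolume (Fin.cons (-(z : EuclideanSpace ℝ (Fin n)))
          (fun i => (u i : EuclideanSpace ℝ (Fin n))))) := by
  have h := absDet_smul (fun i => ‖(u i + z : EuclideanSpace ℝ (Fin n))‖)
    (fun i => ‖(u i + z : EuclideanSpace ℝ (Fin n))‖⁻¹ • (u i + z : EuclideanSpace ℝ (Fin n)))
  have h' : ∀ x : EuclideanSpace ℝ (Fin n), ‖x‖ • ‖x‖⁻¹ • x = x := by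
    intro x
    rcases eq_or_ne x 0 with rfl | hx
    · simp
    · rw [smul_smul, mul_inv_cancel₀ (norm_ne_zero_iff.2 hx), one_smul]
  simp only [h', abs_norm] at h
  rw [factorial_mul_simplexVolume, pivotIntegrand]
  simp only [sub_neg_eq_add]
  rw [h]
  ring

/-- The points `r • z + r • u i` with `u i = sphereDoubling z (v i)` are those on the rays of the
`v i`, and the normalization of `u i + z` is `v i`. -/
theorem pivotIntegrand_sphereDoubling (hn : 1 ≤ n)
    (f : (Fin n → EuclideanSpace ℝ (Fin n)) → ℝ≥0∞) (z : UnitSphere n) {r : ℝ} (hr : 0 < r)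
    (v : Fin n → UnitSphere n) :
    ENNReal.ofReal (r ^ (n - 1)) *
        directionCenterIntegrand f v (r • (z : EuclideanSpace ℝ (Fin n))) =
      (∏ i, 2 * radialDensity n (2 * ⟪(v i : EuclideanSpace ℝ (Fin n)), z⟫)) *
        pivotIntegrand f z r (fun i => sphereDoubling z (v i)) := by
  by_cases hv : ∀ i, 0 < ⟪(v i : EuclideanSpace ℝ (Fin n)), z⟫
  · have hpt : ∀ i, r • (z : EuclideanSpace ℝ (Fin n)) + r • (sphereDoubling z (v i) :
        EuclideanSpace ℝ (Fin n)) = (2 * ⟪(v i : EuclideanSpace ℝ (Fin n)),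
          r • (z : EuclideanSpace ℝ (Fin n))⟫) • (v i : EuclideanSpace ℝ (Fin n)) := by
      intro i
      rw [← smul_add, add_comm, coe_sphereDoubling_add, real_inner_smul_right, smul_smul]
      congr 1
      ring
    have hnormalize : ∀ i, ‖(sphereDoubling z (v i) + z : EuclideanSpace ℝ (Fin n))‖⁻¹ •
        (sphereDoubling z (v i) + z : EuclideanSpace ℝ (Fin n)) = v i := by
      intro i
      have h0 : 0 < 2 * ⟪(v i : EuclideanSpace ℝ (Fin n)), z⟫ := by linarith [hv i]
      rw [coe_sphereDoubling_add, norm_smul, Real.norm_of_nonneg h0.le, norm_eq_of_mem_sphere,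
        mul_one, smul_smul, inv_mul_cancel₀ h0.ne', one_smul]
    have hrd : ∀ i, radialDensity n (2 * ⟪(v i : EuclideanSpace ℝ (Fin n)),
        r • (z : EuclideanSpace ℝ (Fin n))⟫) = ENNReal.ofReal (r ^ (n - 1)) *
          radialDensity n (2 * ⟪(v i : EuclideanSpace ℝ (Fin n)), z⟫) := by
      intro i
      rw [← radialDensity_mul hr, real_inner_smul_right]
      congr 1
      ring
    have hpow : ENNReal.ofReal (r ^ (n ^ 2 - 1)) =
        ENNReal.ofReal (r ^ (n - 1)) * ENNReal.ofReal (r ^ (n - 1)) ^ n := by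
      rw [← ENNReal.ofReal_pow (by positivity), ← ENNReal.ofReal_mul (by positivity), ← pow_mul,
        ← pow_add]
      congr 2
      obtain ⟨m, rfl⟩ : ∃ m, n = m + 1 := ⟨n - 1, by omega⟩
      simp only [Nat.add_sub_cancel]
      have : (m + 1) ^ 2 = m + m * (m + 1) + 1 := by ring
      omega
    simp only [directionCenterIntegrand, pivotIntegrand, hpt, hnormalize, hrd, Finset.prod_mul_distrib,
      Finset.prod_const, Finset.card_univ, Fintype.card_fin, hpow]
    ring
  · push Not at hv
    obtain ⟨i, hi⟩ := hv
    have h1 : ∏ i, 2 * radialDensity n (2 * ⟪(v i : EuclideanSpace ℝ (Fin n)), z⟫) = 0 :=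
      Finset.prod_eq_zero (Finset.mem_univ i) (by
        rw [radialDensity, if_neg (by linarith), mul_zero])
    have h2 : ∏ i, radialDensity n (2 * ⟪(v i : EuclideanSpace ℝ (Fin n)),
        r • (z : EuclideanSpace ℝ (Fin n))⟫) = 0 :=
      Finset.prod_eq_zero (Finset.mem_univ i) (by
        have := mul_nonneg hr.le (neg_nonneg.2 hi)
        rw [real_inner_smul_right, radialDensity, if_neg (by linarith)])
    simp only [directionCenterIntegrand, pivotIntegrand, h1, h2, zero_mul, mul_zero]

theorem lintegral_directionCenter_smul (hn : 1 ≤ n)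
    {f : (Fin n → EuclideanSpace ℝ (Fin n)) → ℝ≥0∞} (hf : Measurable f) (z : UnitSphere n)
    {r : ℝ} (hr : 0 < r) :
    ENNReal.ofReal (r ^ (n - 1)) * ∫⁻ v : Fin n → UnitSphere n,
        directionCenterIntegrand f v (r • (z : EuclideanSpace ℝ (Fin n)))
          ∂Measure.pi (fun _ => sphereMeasure n) =
      ∫⁻ u : Fin n → UnitSphere n,
        f (fun i => r • (z : EuclideanSpace ℝ (Fin n)) + r • (u i : EuclideanSpace ℝ (Fin n))) *
          ENNReal.ofReal (r ^ (n ^ 2 - 1)) *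
          ((n ! : ℝ≥0∞) * simplexVolume (Fin.cons (-(z : EuclideanSpace ℝ (Fin n)))
            (fun i => (u i : EuclideanSpace ℝ (Fin n)))))
        ∂Measure.pi (fun _ => sphereMeasure n) := by
  have hK : Measurable fun v : Fin n → UnitSphere n =>
      directionCenterIntegrand f v (r • (z : EuclideanSpace ℝ (Fin n))) :=
    (measurable_directionCenterIntegrand hf).of_uncurry_right
  simp_rw [← prod_norm_mul_pivotIntegrand]
  rw [← lintegral_pi_sphereDoubling hn z (measurable_pivotIntegrand hf z r),
    ← lintegral_const_mul _ hK]
  exact lintegral_congr fun v => pivotIntegrand_sphereDoubling hn f z hr v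

/-! ### Integration over the center in polar coordinates -/

theorem lintegral_pivoted_of_measurable (hn : 1 ≤ n)
    {f : (Fin n → EuclideanSpace ℝ (Fin n)) → ℝ≥0∞} (hf : Measurable f) :
    ∫⁻ x : Fin n → EuclideanSpace ℝ (Fin n), f x =
      ∫⁻ r : ℝ in Set.Ici 0, ∫⁻ z : UnitSphere n, ∫⁻ u : Fin n → UnitSphere n,
        f (fun i => r • (z : EuclideanSpace ℝ (Fin n)) + r • (u i : EuclideanSpace ℝ (Fin n))) *
          ENNReal.ofReal (r ^ (n ^ 2 - 1)) *
          ((n ! : ℝ≥0∞) * simplexVolume (Fin.cons (-(z : EuclideanSpace ℝ (Fin n)))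
            (fun i => (u i : EuclideanSpace ℝ (Fin n)))))
        ∂(Measure.pi fun _ => sphereMeasure n) ∂(sphereMeasure n) := by
  have hK := measurable_directionCenterIntegrand hf
  have hI : Measurable fun c : EuclideanSpace ℝ (Fin n) => ∫⁻ v : Fin n → UnitSphere n,
      directionCenterIntegrand f v c ∂Measure.pi fun _ => sphereMeasure n :=
    hK.lintegral_prod_left'
  rw [lintegral_eq_lintegral_directionCenter hn hf, lintegral_lintegral_swap hK.aemeasurable,
    lintegral_polar hn hI, lintegral_lintegral_swap, restrict_Ioi_eq_restrict_Ici.symm]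
  · refine setLIntegral_congr_fun measurableSet_Ioi fun r hr => lintegral_congr fun z => ?_
    exact lintegral_directionCenter_smul hn hf z hr
  · exact Measurable.aemeasurable (by fun_prop)

end

theorem theorem1 (n : ℕ) (hn : 1 ≤ n)
    (f : (Fin n → EuclideanSpace ℝ (Fin n)) → ℝ≥0∞) (hf : AEMeasurable f volume) :
    ∫⁻ x : Fin n → EuclideanSpace ℝ (Fin n), f x =
      ∫⁻ r : ℝ in Set.Ici 0,
        ∫⁻ z : UnitSphere n,
          ∫⁻ u : Fin n → UnitSphere n,
            f (fun i => r • (z : EuclideanSpace ℝ (Fin n)) +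
                r • (u i : EuclideanSpace ℝ (Fin n))) *
              ENNReal.ofReal (r ^ (n ^ 2 - 1)) *
              ((n ! : ℝ≥0∞) *
                simplexVolume (Fin.cons (-(z : EuclideanSpace ℝ (Fin n)))
                  (fun i => (u i : EuclideanSpace ℝ (Fin n)))))
            ∂(Measure.pi fun _ => sphereMeasure n)
          ∂(sphereMeasure n) := by
  obtain ⟨g, hg, hfg⟩ := hf
  rw [lintegral_congr_ae hfg, lintegral_pivoted_of_measurable hn hg]
  -- The formula for the indicator of a measurable null set `N` shows that, for almost all
  -- `(r, z, u)`, the points avoid `N` or the weight vanishes.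
  set N := toMeasurable volume {x | f x ≠ g x} with hN
  have hNm : MeasurableSet N := measurableSet_toMeasurable _ _
  have hfgN : ∀ x ∉ N, f x = g x := fun x hx => by
    by_contra h
    exact hx (subset_toMeasurable _ _ h)
  have h0 : ∫⁻ x, N.indicator (1 : (Fin n → EuclideanSpace ℝ (Fin n)) → ℝ≥0∞) x = 0 := by
    rw [lintegral_indicator_one hNm, hN, measure_toMeasurable]
    exact ae_iff.1 hfg
  have hind : Measurable (N.indicator (1 : (Fin n → EuclideanSpace ℝ (Fin n)) → ℝ≥0∞)) :=
    measurable_one.indicator hNm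
  have hdm := measurable_absDet (n := n)
  rw [lintegral_pivoted_of_measurable hn hind] at h0
  simp only [factorial_mul_simplexVolume] at h0 ⊢
  have hW : Measurable fun q : (ℝ × UnitSphere n) × (Fin n → UnitSphere n) =>
      N.indicator (1 : (Fin n → EuclideanSpace ℝ (Fin n)) → ℝ≥0∞)
        (fun i => q.1.1 • (q.1.2 : EuclideanSpace ℝ (Fin n)) +
          q.1.1 • (q.2 i : EuclideanSpace ℝ (Fin n))) *
        ENNReal.ofReal (q.1.1 ^ (n ^ 2 - 1)) *
        absDet (fun i => (q.2 i : EuclideanSpace ℝ (Fin n)) -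
          -(q.1.2 : EuclideanSpace ℝ (Fin n))) := by
    fun_prop
  have hW' := hW.lintegral_prod_right' (ν := Measure.pi fun _ => sphereMeasure n)
  have hW'' := hW'.lintegral_prod_right' (ν := sphereMeasure n)
  rw [lintegral_eq_zero_iff hW''] at h0
  refine lintegral_congr_ae ?_
  filter_upwards [h0] with r hr
  have hr := (lintegral_eq_zero_iff (hW'.comp measurable_prodMk_left)).1 hr
  refine lintegral_congr_ae ?_
  filter_upwards [hr] with z hz
  have hz := (lintegral_eq_zero_iff (hW.comp measurable_prodMk_left)).1 hz
  refine lintegral_congr_ae ?_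
  filter_upwards [hz] with u hu
  by_cases hx : (fun i => r • (z : EuclideanSpace ℝ (Fin n)) +
      r • (u i : EuclideanSpace ℝ (Fin n))) ∈ N
  · simp only [Function.comp_apply, Set.indicator_of_mem hx, Pi.one_apply, one_mul,
      Pi.zero_apply] at hu
    simp only [mul_assoc, hu, mul_zero]
  · rw [hfgN _ hx]
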